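/- Let $\mathcal G$ be a real normed space and $\mathcal H$ a real Hilbert space. Let $0\le m\le n$ be integers, $I=\{1,\dots,m\}$, $I_0=\{m+1,\dots,n\}$ (either set may be empty), and let $h_i:\mathcal G\times\mathcal H\to\mathbb R$, $i=1,\dots,n$, be jointly continuous, differentiable in $x$, with partial gradients $\nabla_x h_i$ jointly continuous on $\mathcal G\times\mathcal H$. For $p\in\mathcal G$ put $$F(p)=\{x\in\mathcal H \mid h_i(p,x)\le 0,\ i\in I,\ \ h_i(p,x)=0,\ i\in I_0\},\qquad \operatorname{dom}F=\{p\in\mathcal G\mid F(p)\neq\emptyset\}.$$ Let $x^0\in F(p^0)$, and assume that each $h_i$ is (jointly) Lipschitz continuous on some neighbourhood of $(p^0,x^0)$. Suppose that 1. $F$ is lower semicontinuous at $(p^0,x^0)$ relative to $\operatorname{dom}F$: for every neighbourhood $V$ of $x^0$ there is a neighbourhood $U$ of $p^0$ such that $F(p)\cap V\neq\emptyset$ for all $p\in U\cap\operatorname{dom}F$; 2. $F$ satisfies the relaxed constant rank constraint qualification (RCRCQ) at $(p^0,x^0)$ relative to $\operatorname{dom}F\times\mathcal H$: for every index set $K\subset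 I(p^0,x^0):=\{i\in I\mid h_i(p^0,x^0)=0\}$ there is a neighbourhood $W$ of $(p^0,x^0)$ such that $$\operatorname{rank}\{\nabla_x h_i(p,x): i\in I_0\cup K\}=\operatorname{rank}\{\nabla_x h_i(p^0,x^0): i\in I_0\cup K\}\quad\text{for all }(p,x)\in W\cap(\operatorname{dom}F\times\mathcal H).$$ Then $F$ is Lipschitz-like (pseudo-Lipschitzian, i.e. has the Aubin property) at $(p^0,x^0)$ relative to $\operatorname{dom}F$: there exist a number $l_F>0$ and neighbourhoods $U$ of $p^0$ and $V$ of $x^0$ such that $$F(p^1)\cap V\subset F(p^2)+l_F\|p^2-p^1\|B\qquad\text{for all }p^1,p^2\in U\cap\operatorname{dom}F,$$ where $B$ is the open unit ball of $\mathcal H$. -/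

import Mathlib

open Set Topology
open scoped Pointwise NNReal

namespace ParamSystem

section SetValued

variable {G H : Type*}

/-- The domain of a set-valued mapping: the parameters with nonempty value. -/
def dom (F : G → Set H) : Set G := {p | (F p).Nonempty}

/-- Lower semicontinuity of the set-valued mapping `F` at the point `(p₀, x₀)` of its graph,
relative to the set `P` of parameters. -/
def LowerSemicontAt [TopologicalSpace G] [TopologicalSpace H]
    (F : G → Set H) (P : Set G) (p₀ : G) (x₀ : H) : Prop :=
  ∀ V ∈ 𝓝 x₀, ∃ U ∈ 𝓝 p₀, ∀ p ∈ U ∩ P, (F p ∩ V).Nonempty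

/-- The Lipschitz-like property (pseudo-Lipschitz continuity, Aubin property) of the set-valued
mapping `F` at the point `(p₀, x₀)` of its graph, relative to the set `P` of parameters.
`Metric.ball 0 1` is the open unit ball of `H`. -/
def LipschitzLikeAt [NormedAddCommGroup G] [NormedAddCommGroup H] [NormedSpace ℝ H]
    (F : G → Set H) (P : Set G) (p₀ : G) (x₀ : H) : Prop :=
  ∃ l : ℝ, 0 < l ∧ ∃ U ∈ 𝓝 p₀, ∃ V ∈ 𝓝 x₀, ∀ p₁ ∈ U ∩ P, ∀ p₂ ∈ U ∩ P,
    F p₁ ∩ V ⊆ F p₂ + (l * ‖p₂ - p₁‖) • Metric.ball (0 : H) 1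

end SetValued

section System

variable {ι G H : Type*}

/-- The solution set of the parametric system with inequality constraints `h i p x ≤ 0` for
`i ∈ I` and equality constraints `h i p x = 0` for `i ∈ I₀`. -/
def feasible (I I₀ : Set ι) (h : ι → G → H → ℝ) (p : G) : Set H :=
  {x | (∀ i ∈ I, h i p x ≤ 0) ∧ ∀ i ∈ I₀, h i p x = 0}

/-- The indices of the inequality constraints that are active at `(p, x)`. -/
def active (I : Set ι) (h : ι → G → H → ℝ) (p : G) (x : H) : Set ι :=
  {i | i ∈ I ∧ h i p x = 0}

/-- The rank of the family of partial gradients `∇ₓ h i (p, x)`, `i ∈ J`, that is, the dimension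
of their linear span. -/
noncomputable def gradRank [NormedAddCommGroup H] [InnerProductSpace ℝ H] [CompleteSpace H]
    (h : ι → G → H → ℝ) (J : Set ι) (p : G) (x : H) : ℕ :=
  Set.finrank ℝ ((fun i => gradient (h i p) x) '' J)

/-- The relaxed constant rank constraint qualification at `(p₀, x₀)` relative to `P × X`. -/
def RCRCQ [TopologicalSpace G] [NormedAddCommGroup H] [InnerProductSpace ℝ H] [CompleteSpace H]
    (I I₀ : Set ι) (h : ι → G → H → ℝ) (P : Set G) (X : Set H) (p₀ : G) (x₀ : H) : Prop :=
  ∀ K ⊆ active I h p₀ x₀, ∃ W ∈ 𝓝 (p₀, x₀), ∀ z ∈ W ∩ P ×ˢ X,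
    gradRank h (I₀ ∪ K) z.1 z.2 = gradRank h (I₀ ∪ K) p₀ x₀

end System

end ParamSystem

/-!
The distance from a point `x` near `x₀` to `F p` is bounded by a multiple of the residual of `x` in
the system with parameter `p`, uniformly in `p ∈ dom F` near `p₀`. For `x ∈ F p₁` the residual at
`p₂` is at most a multiple of `‖p₂ - p₁‖`, since the constraint functions are Lipschitz continuous,
and the Lipschitz-like property follows (`ParamSystem.lipschitzLikeAt_feasible`).

In an infinite-dimensional space `x` need not have a projection onto `F p`, so the error bound comes
from a descent argument. Suppose that every `y ∈ F p` is far from `x` compared with the residual.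
Lower semicontinuity supplies a starting point `y ∈ F p` near `x₀`. For any feasible `y` near `x₀`
the vector `v = x - y` satisfies the constraints linearized at `y` up to a small multiple of `‖v‖`.
A Hoffman estimate gives an exact solution `d` of the linearized system within `‖v‖ / 2` of `v`
(`ParamSystem.RCRCQ.eventually_exists_linearized_near`), and there is an arc in `F p` starting at
`y` with velocity `d` (`exists_feasible_arc`). Moving along it decreases the distance to `x` at a
fixed rate, which contradicts Ekeland's variational principle (`exists_no_descent`) on the complete
set of feasible points near `x`.

The rank condition enters twice. In the Hoffman estimate, `v - d` is the projection of `v` onto the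
cone of active gradients; by Carathéodory's theorem it is a combination of linearly independent
gradients, among them a basis of the equality gradients. Constant rank makes these linearly
independent at `(p₀, x₀)` too, so the coefficients have a uniform bound. For the arcs, constant rank
near `y` makes all constraints that are to stay constant depend on those of a basis
(`exists_arc_of_subset_span`).
-/

section

open Filter

/-! ### Ekeland's variational principle -/

/-- **Ekeland's variational principle**, for a nonnegative continuous function: some point `x`
admits no `y ≠ x` at which the value of `f` is smaller than `f x` by at least `c * dist x y`. -/
theorem exists_no_descent {X : Type*} [MetricSpace X] [CompleteSpace X] [Nonempty X]
    {f : X → ℝ} (hf : Continuous f) (hb : ∀ x, 0 ≤ f x) {c : ℝ} (hc : 0 < c) :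
    ∃ x, ∀ y, f y + c * dist x y ≤ f x → y = x := by
  classical
  have bdd : ∀ x, BddBelow (f '' {y | f y + c * dist x y ≤ f x}) := fun x =>
    ⟨0, by rintro _ ⟨y, -, rfl⟩; exact hb y⟩
  have step : ∀ x, ∃ y, f y + c * dist x y ≤ f x ∧
      ∀ z, f z + c * dist x z ≤ f x → 2 * f y - f x ≤ f z := by
    intro x
    have hself : f x + c * dist x x ≤ f x := by simp
    have hne : (f '' {y | f y + c * dist x y ≤ f x}).Nonempty := ⟨f x, x, hself, rfl⟩
    set v := sInf (f '' {y | f y + c * dist x y ≤ f x}) with hv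
    have hvle : ∀ z, f z + c * dist x z ≤ f x → v ≤ f z := fun z hz =>
      csInf_le (bdd x) ⟨z, hz, rfl⟩
    rcases (hvle x hself).lt_or_eq with hlt | heq
    · obtain ⟨_, ⟨y, hy, rfl⟩, hy2⟩ := exists_lt_of_csInf_lt hne
        (show v < (v + f x) / 2 by linarith)
      exact ⟨y, hy, fun z hz => by have := hvle z hz; linarith⟩
    · exact ⟨x, hself, fun z hz => by have := hvle z hz; linarith⟩
  -- The step `x ↦ g x` takes the value of `f` at least half of the way down to the infimum of `f`
  -- over the points reachable from `x` by descent; its iterates form a Cauchy sequence.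
  choose g hg1 hg2 using step
  let u : ℕ → X := fun n => g^[n] (Classical.arbitrary X)
  have hu : ∀ n, u (n + 1) = g (u n) := fun n => Function.iterate_succ_apply' g n _
  have hle : ∀ n k, f (u (n + k)) + c * dist (u n) (u (n + k)) ≤ f (u n) := by
    intro n k
    induction k with
    | zero => simp
    | succ k ih =>
      have h1 := hg1 (u (n + k))
      rw [← hu, add_assoc] at h1
      have h2 := mul_le_mul_of_nonneg_left
        (dist_triangle (u n) (u (n + k)) (u (n + (k + 1)))) hc.le
      linarith
  have hanti : Antitone fun n => f (u n) := antitone_nat_of_succ_le fun n => by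
    have := hle n 1
    have h2 := mul_nonneg hc.le (dist_nonneg (x := u n) (y := u (n + 1)))
    linarith
  obtain ⟨L, hL⟩ : ∃ L, Tendsto (fun n => f (u n)) atTop (𝓝 L) :=
    ⟨_, tendsto_atTop_ciInf hanti ⟨0, by rintro _ ⟨n, rfl⟩; exact hb _⟩⟩
  have hLle : ∀ n, L ≤ f (u n) := fun n => hanti.le_of_tendsto hL n
  have hcau : CauchySeq u := by
    refine cauchySeq_of_le_tendsto_0' (fun n => (f (u n) - L) / c) ?_ ?_
    · intro n m hnm
      obtain ⟨k, rfl⟩ := Nat.exists_eq_add_of_le hnm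
      rw [le_div_iff₀ hc]
      have := hle n k
      have := hLle (n + k)
      linarith
    · simpa using (hL.sub_const L).div_const c
  obtain ⟨x, hx⟩ := cauchySeq_tendsto_of_complete hcau
  have hfx : f x = L := tendsto_nhds_unique ((hf.tendsto x).comp hx) hL
  refine ⟨x, fun y hy => ?_⟩
  have hux : ∀ n, f x + c * dist (u n) x ≤ f (u n) := by
    intro n
    have h1 : Tendsto (fun k => f (u (k + n)) + c * dist (u n) (u (k + n))) atTop
        (𝓝 (f x + c * dist (u n) x)) := by
      have hx' := (tendsto_add_atTop_iff_nat n).2 hx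
      exact ((hf.tendsto x).comp hx').add ((tendsto_const_nhds.dist hx').const_mul c)
    exact le_of_tendsto' h1 fun k => by rw [add_comm k n]; exact hle n k
  have hyL : L ≤ f y := by
    have h1 : Tendsto (fun n => 2 * f (u (n + 1)) - f (u n)) atTop (𝓝 (2 * L - L)) :=
      (((tendsto_add_atTop_iff_nat 1).2 hL).const_mul 2).sub hL
    have h2 : 2 * L - L ≤ f y := le_of_tendsto' h1 fun n => by
      rw [hu]
      refine hg2 (u n) y ?_
      have := hux n
      have := mul_le_mul_of_nonneg_left (dist_triangle (u n) x y) hc.le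
      linarith
    linarith
  have : c * dist x y ≤ 0 := by linarith
  have : dist x y ≤ 0 := by nlinarith
  exact (dist_le_zero.1 this).symm

/-! ### Finitely generated cones -/

section Cone

variable {ι V : Type*} [AddCommGroup V] [Module ℝ V]

/-- **Carathéodory's theorem for cones**, relative to a linearly independent part `B` whose
coefficients may have any sign: a combination that is nonnegative off `B` can be rewritten on a
linearly independent set of indices that still contains all of `B`. -/
theorem exists_linearIndepOn_conic [DecidableEq ι] (a : ι → V) {B : Finset ι}
    (hB : LinearIndepOn ℝ a (B : Set ι)) (S : Finset ι) (hBS : B ⊆ S) (l : ι → ℝ)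
    (hl : ∀ i ∈ S, i ∉ B → 0 ≤ l i) :
    ∃ T, B ⊆ T ∧ T ⊆ S ∧ LinearIndepOn ℝ a (T : Set ι) ∧ ∃ l' : ι → ℝ,
      (∀ i ∈ T, i ∉ B → 0 ≤ l' i) ∧ ∑ i ∈ T, l' i • a i = ∑ i ∈ S, l i • a i := by
  induction S using Finset.strongInduction generalizing l with
  | H S ih =>
    by_cases hS : LinearIndepOn ℝ a (S : Set ι)
    · exact ⟨S, hBS, Subset.rfl, hS, l, hl, rfl⟩
    obtain ⟨μ, hμ, i₀, hi₀S, hi₀B, hi₀⟩ : ∃ μ : ι → ℝ, ∑ i ∈ S, μ i • a i = 0 ∧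
        ∃ i ∈ S, i ∉ B ∧ 0 < μ i := by
      simp only [linearIndepOn_finset_iff, not_forall] at hS
      obtain ⟨μ, hμ, i, hi, hne⟩ := hS
      have : ∃ j ∈ S, j ∉ B ∧ μ j ≠ 0 := by
        by_contra! hcon
        have hB' := linearIndepOn_finset_iff.1 hB μ (by
          rw [← hμ]
          refine Finset.sum_subset hBS fun j hj hjB => ?_
          rw [hcon j hj hjB, zero_smul])
        by_cases hiB : i ∈ B
        · exact hne (hB' i hiB)
        · exact hne (hcon i hi hiB)
      obtain ⟨j, hj, hjB, hj0⟩ := this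
      rcases hj0.lt_or_gt with h | h
      · exact ⟨-μ, by simp [hμ], j, hj, hjB, by simpa using h⟩
      · exact ⟨μ, hμ, j, hj, hjB, h⟩
    -- The smallest ratio `l i / μ i` is the largest multiple of `μ` that can be subtracted from `l`
    -- without losing nonnegativity off `B`; it removes the index `k`.
    obtain ⟨k, hk, hmin⟩ := Finset.exists_min_image
      (S.filter fun i => i ∉ B ∧ 0 < μ i) (fun i => l i / μ i)
      ⟨i₀, by simp [hi₀S, hi₀B, hi₀]⟩
    simp only [Finset.mem_filter] at hk hmin
    obtain ⟨hkS, hkB, hk0⟩ := hk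
    have hlk : 0 ≤ l k / μ k := div_nonneg (hl k hkS hkB) hk0.le
    obtain ⟨T, hBT, hTS, hT, l', hl', hsum⟩ := ih (S.erase k) (Finset.erase_ssubset hkS)
      (fun i hi => Finset.mem_erase.2 ⟨fun h => hkB (h ▸ hi), hBS hi⟩)
      (fun i => l i - l k / μ k * μ i) (by
        intro i hi hiB
        have hiS := Finset.mem_of_mem_erase hi
        rcases le_or_gt (μ i) 0 with h | h
        · have := hl i hiS hiB
          have := mul_nonpos_of_nonneg_of_nonpos hlk h
          linarith
        · have := hmin i ⟨hiS, hiB, h⟩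
          rw [le_div_iff₀ h] at this
          linarith)
    refine ⟨T, hBT, hTS.trans (Finset.erase_subset _ _), hT, l', hl', hsum.trans ?_⟩
    rw [Finset.sum_erase _ (by rw [div_mul_cancel₀ _ hk0.ne', sub_self, zero_smul])]
    simp only [sub_smul, Finset.sum_sub_distrib, mul_smul, ← Finset.smul_sum, hμ, smul_zero,
      sub_zero]

end Cone

section Projection

variable {ι H : Type*} [NormedAddCommGroup H] [InnerProductSpace ℝ H]

/-- The cone generated by a linearly independent family, with coefficients of any sign on `B`, is
closed: it is the image of a closed set under an injective linear map from a finite-dimensional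
space. -/
theorem isClosed_simplicialCone (a : ι → H) {T : Finset ι} (hT : LinearIndepOn ℝ a (T : Set ι))
    (B : Finset ι) :
    IsClosed {c | ∃ l : ι → ℝ, (∀ i ∈ T, i ∉ B → 0 ≤ l i) ∧ ∑ i ∈ T, l i • a i = c} := by
  classical
  have hT' : LinearIndependent ℝ fun i : T => a i := hT
  have hker : (Fintype.linearCombination ℝ fun i : T => a i).ker = ⊥ :=
    LinearMap.ker_eq_bot.2 (hT'.fintypeLinearCombination_injective)
  have hcl := (LinearMap.isClosedEmbedding_of_injective hker).isClosedMap
    {l : T → ℝ | ∀ i : T, (i : ι) ∉ B → 0 ≤ l i} (by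
      simp only [ofPred_forall]
      exact isClosed_iInter fun i => isClosed_iInter fun _ =>
        isClosed_le continuous_const (continuous_apply i))
  convert hcl using 1
  ext c
  constructor
  · rintro ⟨l, hl, rfl⟩
    refine ⟨fun i => l i, fun i hi => hl i i.2 hi, ?_⟩
    rw [Fintype.linearCombination_apply, ← Finset.sum_coe_sort T (fun i => l i • a i)]
  · rintro ⟨l, hl, rfl⟩
    refine ⟨fun i => if hi : i ∈ T then l ⟨i, hi⟩ else 0, fun i hi hiB => ?_, ?_⟩
    · simpa [hi] using hl ⟨i, hi⟩ hiB
    · rw [Fintype.linearCombination_apply, ← Finset.sum_coe_sort T]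
      simp

/-- **Moreau decomposition** of `v` with respect to a polyhedral cone: the difference of `v` and its
projection `∑ i ∈ T, l i • a i` onto the cone generated by the `a i`, `i ∈ S`, and the `-a i`,
`i ∈ B`, lies in the polar cone. By Carathéodory's theorem the projection is a combination of
linearly independent generators. -/
theorem exists_polyhedral_projection [CompleteSpace H] [DecidableEq ι] (a : ι → H) {B S : Finset ι}
    (hB : LinearIndepOn ℝ a (B : Set ι)) (hBS : B ⊆ S) (v : H) :
    ∃ T, B ⊆ T ∧ T ⊆ S ∧ LinearIndepOn ℝ a (T : Set ι) ∧ ∃ l : ι → ℝ,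
      inner ℝ (v - ∑ i ∈ T, l i • a i) (∑ i ∈ T, l i • a i) = 0 ∧
      (∀ i ∈ T, i ∉ B → 0 ≤ l i) ∧
      (∀ i ∈ B, inner ℝ (a i) (v - ∑ i ∈ T, l i • a i) = 0) ∧
      ∀ i ∈ S, inner ℝ (a i) (v - ∑ i ∈ T, l i • a i) ≤ 0 := by
  set C : Set H := {c | ∃ l : ι → ℝ, (∀ i ∈ S, i ∉ B → 0 ≤ l i) ∧ ∑ i ∈ S, l i • a i = c} with hC
  have hred : ∀ c ∈ C, ∃ T, B ⊆ T ∧ T ⊆ S ∧ LinearIndepOn ℝ a (T : Set ι) ∧ ∃ l : ι → ℝ,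
      (∀ i ∈ T, i ∉ B → 0 ≤ l i) ∧ ∑ i ∈ T, l i • a i = c := by
    rintro c ⟨l, hl, rfl⟩
    exact exists_linearIndepOn_conic a hB S hBS l hl
  -- A finitely generated cone is the union of its finitely many simplicial subcones.
  have hclosed : IsClosed C := by
    have : C = ⋃ T ∈ {T ∈ (S.powerset : Set (Finset ι)) | LinearIndepOn ℝ a (T : Set ι)},
        {c | ∃ l : ι → ℝ, (∀ i ∈ T, i ∉ B → 0 ≤ l i) ∧ ∑ i ∈ T, l i • a i = c} := by
      ext c
      simp only [mem_iUnion, exists_prop]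
      constructor
      · intro hc
        obtain ⟨T, -, hTS, hT, l, hl, h⟩ := hred c hc
        exact ⟨T, ⟨by simpa using hTS, hT⟩, l, hl, h⟩
      · rintro ⟨T, ⟨hTS, -⟩, l, hl, rfl⟩
        have hTS : T ⊆ S := by simpa using hTS
        refine ⟨fun i => if i ∈ T then l i else 0, fun i _ hiB => ?_, ?_⟩
        · dsimp only
          split_ifs with h
          exacts [hl i h hiB, le_rfl]
        · simp only [ite_smul, zero_smul, Finset.sum_ite_mem, Finset.inter_eq_right.2 hTS]
    rw [this]
    exact ((Finset.finite_toSet _).subset (sep_subset _ _)).isClosed_biUnion fun T hT =>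
      isClosed_simplicialCone a hT.2 B
  have hadd : ∀ c ∈ C, ∀ c' ∈ C, ∀ s t : ℝ, 0 ≤ s → 0 ≤ t → s • c + t • c' ∈ C := by
    rintro _ ⟨l, hl, rfl⟩ _ ⟨l', hl', rfl⟩ s t hs ht
    refine ⟨fun i => s * l i + t * l' i, fun i hi hiB => ?_, ?_⟩
    · have := mul_nonneg hs (hl i hi hiB)
      have := mul_nonneg ht (hl' i hi hiB)
      linarith
    · simp only [add_smul, mul_smul, Finset.sum_add_distrib, Finset.smul_sum]
  have hconv : Convex ℝ C := fun c hc c' hc' s t hs ht _ => hadd c hc c' hc' s t hs ht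
  have h0 : (0 : H) ∈ C := ⟨0, by simp, by simp⟩
  obtain ⟨c, hc, hmin⟩ := exists_norm_eq_iInf_of_complete_convex ⟨0, h0⟩
    hclosed.isComplete hconv v
  have hvar := (norm_eq_iInf_iff_real_inner_le_zero hconv hc).1 hmin
  have hvar' : ∀ w ∈ C, inner ℝ (v - c) w ≤ 0 := fun w hw => by
    have := hvar (c + w) (by simpa using hadd c hc w hw 1 1 zero_le_one zero_le_one)
    simpa using this
  have horth : inner ℝ (v - c) c = 0 := by
    refine le_antisymm (hvar' c hc) ?_
    have := hvar 0 h0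
    rw [zero_sub, inner_neg_right] at this
    linarith
  have hsingle : ∀ i ∈ S, ∀ r : ℝ, (i ∉ B → 0 ≤ r) → r • a i ∈ C := fun i hi r hr => by
    refine ⟨Pi.single i r, fun j _ hjB => ?_, ?_⟩
    · rcases eq_or_ne j i with rfl | hji
      · simpa using hr hjB
      · simp [hji]
    · rw [Finset.sum_eq_single_of_mem i hi fun j _ hji => by simp [hji]]
      simp
  have hS : ∀ i ∈ S, inner ℝ (a i) (v - c) ≤ 0 := fun i hi => by
    have := hvar' _ (hsingle i hi 1 fun _ => zero_le_one)
    rwa [one_smul, real_inner_comm] at this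
  obtain ⟨T, hBT, hTS, hT, l, hl, rfl⟩ := hred c hc
  refine ⟨T, hBT, hTS, hT, l, horth, hl, fun i hi => le_antisymm (hS i (hBS hi)) ?_, hS⟩
  have := hvar' _ (hsingle i (hBS hi) (-1) fun h => absurd hi h)
  rw [neg_smul, one_smul, inner_neg_right, real_inner_comm] at this
  linarith

theorem exists_bound_coeff (a : ι → H) {T : Finset ι} (hT : LinearIndepOn ℝ a (T : Set ι)) :
    ∃ C : ℝ, 0 < C ∧ ∀ l : ι → ℝ, ∑ i ∈ T, |l i| ≤ C * ‖∑ i ∈ T, l i • a i‖ := by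
  classical
  have hT' : LinearIndependent ℝ fun i : T => a i := hT
  obtain ⟨K, hK0, hK⟩ := LinearMap.exists_antilipschitzWith
    (Fintype.linearCombination ℝ fun i : T => a i)
    (LinearMap.ker_eq_bot.2 (hT'.fintypeLinearCombination_injective))
  refine ⟨(T.card + 1) * K, by positivity, fun l => ?_⟩
  have h1 := hK.le_mul_dist (fun i : T => l i) 0
  rw [map_zero, dist_zero_right, dist_zero_right, Fintype.linearCombination_apply,
    Finset.sum_coe_sort T (fun i => l i • a i)] at h1
  have h2 : ∑ i ∈ T, |l i| ≤ T.card * ‖fun i : T => l i‖ := by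
    rw [← nsmul_eq_mul]
    exact Finset.sum_le_card_nsmul _ _ _ fun i hi => norm_le_pi_norm (fun i : T => l i) ⟨i, hi⟩
  have h3 : (0 : ℝ) ≤ K * ‖∑ i ∈ T, l i • a i‖ := by positivity
  have h4 := mul_le_mul_of_nonneg_left h1 (Nat.cast_nonneg (α := ℝ) T.card)
  linarith

/-- Coefficients are bounded by the norm of the combination, with one constant for all nearby
families and all sets of indices on which the limit family is linearly independent. -/
theorem eventually_bound_coeff {Z : Type*} {f : Filter Z} [Finite ι] {a : Z → ι → H} {a₀ : ι → H}
    (ha : ∀ i, Tendsto (fun z => a z i) f (𝓝 (a₀ i))) :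
    ∃ C : ℝ, 0 < C ∧ ∀ᶠ z in f, ∀ T : Finset ι, LinearIndepOn ℝ a₀ (T : Set ι) →
      ∀ l : ι → ℝ, ∑ i ∈ T, |l i| ≤ C * ‖∑ i ∈ T, l i • a z i‖ := by
  classical
  cases nonempty_fintype ι
  have : ∀ T : Finset ι, ∃ C : ℝ, 0 < C ∧ (LinearIndepOn ℝ a₀ (T : Set ι) →
      ∀ l : ι → ℝ, ∑ i ∈ T, |l i| ≤ C * ‖∑ i ∈ T, l i • a₀ i‖) := fun T => by
    by_cases hT : LinearIndepOn ℝ a₀ (T : Set ι)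
    · obtain ⟨C, hC, h⟩ := exists_bound_coeff a₀ hT
      exact ⟨C, hC, fun _ => h⟩
    · exact ⟨1, one_pos, fun h => absurd h hT⟩
  choose C hC0 hC using this
  have hsum : ∀ T, C T ≤ ∑ T, C T := fun T =>
    Finset.single_le_sum (fun T _ => (hC0 T).le) (Finset.mem_univ T)
  set M := ∑ T, C T
  have hM : 0 < M := (hC0 ∅).trans_le (hsum ∅)
  have hev : ∀ᶠ z in f, ∀ i, ‖a z i - a₀ i‖ < 1 / (2 * M) := eventually_all.2 fun i => by
    have h1 := ((ha i).sub_const (a₀ i)).norm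
    rw [sub_self, norm_zero] at h1
    exact h1.eventually_lt_const (by positivity)
  refine ⟨2 * M, by positivity, hev.mono fun z hz T hT l => ?_⟩
  have h1 : ‖∑ i ∈ T, l i • a₀ i‖ ≤ ‖∑ i ∈ T, l i • a z i‖ + (∑ i ∈ T, |l i|) * (1 / (2 * M)) := by
    have h2 : ∑ i ∈ T, l i • a₀ i = ∑ i ∈ T, l i • a z i - ∑ i ∈ T, l i • (a z i - a₀ i) := by
      simp [smul_sub]
    rw [h2]
    refine (norm_sub_le _ _).trans ?_
    gcongr
    rw [Finset.sum_mul]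
    refine norm_sum_le_of_le _ fun i _ => ?_
    rw [norm_smul, Real.norm_eq_abs]
    gcongr
    exact (hz i).le
  have h3 := (hC T hT l).trans (mul_le_mul_of_nonneg_right (hsum T) (norm_nonneg _))
  have h4 := mul_le_mul_of_nonneg_left h1 hM.le
  have h5 : M * ((∑ i ∈ T, |l i|) * (1 / (2 * M))) = (∑ i ∈ T, |l i|) / 2 := by
    field_simp
  rw [mul_add, h5] at h4
  linarith

end Projection

/-! ### Families of constant rank -/

section Rank

variable {ι V : Type*} [Finite ι]

theorem finrank_image_of_linearIndepOn [AddCommGroup V] [Module ℝ V] {a : ι → V} {B : Set ι}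
    (hB : LinearIndepOn ℝ a B) : Set.finrank ℝ (a '' B) = B.ncard := by
  classical
  cases nonempty_fintype ι
  have hB' : LinearIndependent ℝ fun i : B => a i := hB
  rw [Set.finrank, image_eq_range, finrank_span_eq_card hB', ← Nat.card_eq_fintype_card,
    Nat.card_coe_set_eq]

theorem linearIndepOn_of_ncard_le [AddCommGroup V] [Module ℝ V] {a : ι → V} {B : Set ι}
    (hB : B.ncard ≤ Set.finrank ℝ (a '' B)) : LinearIndepOn ℝ a B := by
  classical
  cases nonempty_fintype ι
  refine linearIndependent_iff_card_le_finrank_span.2 ?_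
  rwa [← Nat.card_eq_fintype_card, Nat.card_coe_set_eq, ← image_eq_range]

/-- If the rank of a family is constant near a limit, a basis chosen at the limit remains a basis
nearby. -/
theorem exists_eventually_basis [NormedAddCommGroup V] [NormedSpace ℝ V] {Z : Type*}
    {f : Filter Z} {a : Z → ι → V} {a₀ : ι → V}
    (ha : ∀ i, Tendsto (fun z => a z i) f (𝓝 (a₀ i))) {S : Set ι}
    (hr : ∀ᶠ z in f, Set.finrank ℝ (a z '' S) = Set.finrank ℝ (a₀ '' S)) :
    ∃ B ⊆ S, LinearIndepOn ℝ a₀ B ∧ a₀ '' S ⊆ Submodule.span ℝ (a₀ '' B) ∧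
      ∀ᶠ z in f, LinearIndepOn ℝ (a z) B ∧ a z '' S ⊆ Submodule.span ℝ (a z '' B) := by
  obtain ⟨B, hBS, -, hspan, hB⟩ := exists_linearIndepOn_extension
    (linearIndepOn_empty ℝ a₀) (empty_subset S)
  refine ⟨B, hBS, hB, hspan, ?_⟩
  have hB' : LinearIndependent ℝ fun i : B => a₀ i := hB
  have hev : ∀ᶠ z in f, LinearIndependent ℝ fun i : B => a z i :=
    (tendsto_pi_nhds.2 fun i : B => ha i).eventually hB'.eventually
  have heq : Submodule.span ℝ (a₀ '' B) = Submodule.span ℝ (a₀ '' S) :=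
    le_antisymm (Submodule.span_mono (image_mono hBS)) (Submodule.span_le.2 hspan)
  filter_upwards [hev, hr] with z hz hrz
  have hz' : LinearIndepOn ℝ (a z) B := hz
  refine ⟨hz', ?_⟩
  have hfin : FiniteDimensional ℝ (Submodule.span ℝ (a z '' S)) :=
    FiniteDimensional.span_of_finite ℝ ((toFinite S).image _)
  have : Submodule.span ℝ (a z '' B) = Submodule.span ℝ (a z '' S) := by
    refine Submodule.eq_of_le_of_finrank_le (Submodule.span_mono (image_mono hBS)) ?_
    change Set.finrank ℝ (a z '' S) ≤ Set.finrank ℝ (a z '' B)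
    rw [hrz, finrank_image_of_linearIndepOn hz', ← finrank_image_of_linearIndepOn hB,
      Set.finrank, Set.finrank, heq]
  rw [this]
  exact Submodule.subset_span

/-- Constant rank on `S ∪ K` passes linear independence on `B ∪ K` back to the limit `a₀`, when `B`
spans the `S`-part of `a₀`. -/
theorem linearIndepOn_of_finrank_eq [AddCommGroup V] [Module ℝ V] {a a₀ : ι → V}
    {B S K : Set ι} (hBS : B ⊆ S) (hspan : a₀ '' S ⊆ Submodule.span ℝ (a₀ '' B))
    (h : LinearIndepOn ℝ a (B ∪ K))
    (hr : Set.finrank ℝ (a '' (S ∪ K)) = Set.finrank ℝ (a₀ '' (S ∪ K))) :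
    LinearIndepOn ℝ a₀ (B ∪ K) := by
  refine linearIndepOn_of_ncard_le ?_
  have hfin : FiniteDimensional ℝ (Submodule.span ℝ (a '' (S ∪ K))) :=
    FiniteDimensional.span_of_finite ℝ ((toFinite _).image _)
  have h1 : Set.finrank ℝ (a '' (B ∪ K)) ≤ Set.finrank ℝ (a '' (S ∪ K)) :=
    Submodule.finrank_mono (Submodule.span_mono (image_mono (union_subset_union_left _ hBS)))
  have h2 : Submodule.span ℝ (a₀ '' (S ∪ K)) = Submodule.span ℝ (a₀ '' (B ∪ K)) := by
    refine le_antisymm ?_ (Submodule.span_mono (image_mono (union_subset_union_left _ hBS)))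
    rw [image_union, image_union, Submodule.span_union, Submodule.span_union]
    exact sup_le_sup_right (Submodule.span_le.2 hspan) _
  rw [← finrank_image_of_linearIndepOn h]
  refine h1.trans (hr.le.trans ?_)
  rw [Set.finrank, h2, Set.finrank]

end Rank

/-! ### Arcs in level sets -/

section Arc

variable {ι H : Type*} [NormedAddCommGroup H] [InnerProductSpace ℝ H]

/-- A finite linearly independent family has a biorthogonal family. -/
theorem exists_biorthogonal [Fintype ι] [DecidableEq ι] {a : ι → H} (ha : LinearIndependent ℝ a) :
    ∃ b : ι → H, ∀ i j, inner ℝ (a i) (b j) = if i = j then 1 else 0 := by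
  have : FiniteDimensional ℝ (Submodule.span ℝ (range a)) :=
    FiniteDimensional.span_of_finite ℝ (finite_range a)
  let e := Module.Basis.span ha
  refine ⟨fun j => ((InnerProductSpace.toDual ℝ (Submodule.span ℝ (range a))).symm
    (e.coord j).toContinuousLinearMap : Submodule.span ℝ (range a)), fun i j => ?_⟩
  have he : (e i : H) = a i := by simp [e, Module.Basis.span_apply]
  rw [← he, ← Submodule.coe_inner, real_inner_comm, InnerProductSpace.toDual_symm_apply]
  simp [Finsupp.single_apply]

/-- Along a direction orthogonal to the gradients on `S` there is a tangent arc on which all `f i`,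
`i ∈ S`, are constant, provided that near `y` the gradients on `B` span those on `S`. A chart turns
the `f i`, `i ∈ B`, into linear functions, which gives the arc for `B`; the derivatives of the other
`f i` along the arc are combinations of vanishing ones. -/
theorem exists_arc_of_subset_span [CompleteSpace H] [Finite ι] {f : ι → H → ℝ}
    (hf : ∀ i, Differentiable ℝ (f i)) (hg : ∀ i, Continuous (gradient (f i))) {S B : Set ι}
    (hBS : B ⊆ S) {y : H}
    (hB : LinearIndepOn ℝ (fun i => gradient (f i) y) B)
    (hspan : ∀ᶠ x in 𝓝 y, (fun i => gradient (f i) x) '' S ⊆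
      Submodule.span ℝ ((fun i => gradient (f i) x) '' B)) {d : H}
    (hd : ∀ i ∈ S, inner ℝ (gradient (f i) y) d = 0) :
    ∃ γ : ℝ → H, γ 0 = y ∧ HasDerivAt γ d 0 ∧ ∀ᶠ t in 𝓝 (0 : ℝ), ∀ i ∈ S, f i (γ t) = f i y := by
  classical
  cases nonempty_fintype ι
  have hder : ∀ i x, HasFDerivAt (f i) (InnerProductSpace.toDual ℝ H (gradient (f i) x)) x :=
    fun i x => (hf i x).hasGradientAt.hasFDerivAt
  have hC1 : ∀ i, ContDiff ℝ 1 (f i) := fun i => by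
    refine contDiff_one_iff_fderiv.2 ⟨hf i, ?_⟩
    rw [← toDual_comp_gradient]
    exact (InnerProductSpace.toDual ℝ H).continuous.comp (hg i)
  have hB' : LinearIndependent ℝ fun i : B => gradient (f i) y := hB
  obtain ⟨b, hb⟩ := exists_biorthogonal hB'
  -- The chart `Φ` has derivative the identity at `y`, and `⟪∇ f i y, Φ x⟫ = f i x` for `i ∈ B`.
  let Φ : H → H := fun x => x + ∑ j : B, (f j x - inner ℝ (gradient (f j) y) x) • b j
  have hΦ : ContDiff ℝ 1 Φ := contDiff_id.add <| ContDiff.sum fun j _ =>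
    ((hC1 j).sub (contDiff_const.inner ℝ contDiff_id)).smul contDiff_const
  have hΦ' : HasFDerivAt Φ ((ContinuousLinearEquiv.refl ℝ H : H ≃L[ℝ] H) : H →L[ℝ] H) y := by
    have h1 : HasFDerivAt Φ (ContinuousLinearMap.id ℝ H + ∑ j : B,
        (InnerProductSpace.toDual ℝ H (gradient (f j) y) -
          InnerProductSpace.toDual ℝ H (gradient (f j) y)).smulRight (b j)) y := by
      refine (hasFDerivAt_id y).add (HasFDerivAt.fun_sum fun j _ => ?_)
      exact ((hder j y).sub
        (InnerProductSpace.toDual ℝ H (gradient (f j) y)).hasFDerivAt).smul_const (b j)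
    convert h1 using 1
    ext w
    simp
  have hval : ∀ x, ∀ i : B, inner ℝ (gradient (f i) y) (Φ x) = f i x := fun x i => by
    simp only [Φ, inner_add_right, inner_sum, inner_smul_right, hb]
    simp
  let Ψ := hΦ.contDiffAt.localInverse hΦ' one_ne_zero
  have hΨ : ContDiffAt ℝ 1 Ψ (Φ y) := hΦ.contDiffAt.to_localInverse hΦ' one_ne_zero
  have hΨy : Ψ (Φ y) = y := hΦ.contDiffAt.localInverse_apply_image hΦ' one_ne_zero
  have hΦΨ : ∀ᶠ z in 𝓝 (Φ y), Φ (Ψ z) = z :=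
    (hΦ.contDiffAt.hasStrictFDerivAt' hΦ' one_ne_zero).eventually_right_inverse
  have hΨ' : HasFDerivAt Ψ (ContinuousLinearMap.id ℝ H) (Φ y) :=
    (hΦ.contDiffAt.hasStrictFDerivAt' hΦ' one_ne_zero).to_localInverse.hasFDerivAt
  let σ : ℝ → H := fun t => Φ y + t • d
  have hσ0 : σ 0 = Φ y := by simp [σ]
  have hσ : ContDiff ℝ 1 σ := contDiff_const.add (contDiff_id.smul contDiff_const)
  have hσ' : HasDerivAt σ d 0 := by
    have := ((hasDerivAt_id (0 : ℝ)).smul_const d).const_add (Φ y)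
    rwa [one_smul] at this
  let γ : ℝ → H := fun t => Ψ (σ t)
  have hγ0 : γ 0 = y := by simp only [γ, hσ0, hΨy]
  have hγC : ContDiffAt ℝ 1 γ 0 := by
    refine ContDiffAt.comp (0 : ℝ) ?_ hσ.contDiffAt
    rwa [hσ0]
  have hγ' : HasDerivAt γ d 0 := by
    rw [← hσ0] at hΨ'
    exact hΨ'.comp_hasDerivAt (0 : ℝ) hσ'
  have hσt : Tendsto σ (𝓝 0) (𝓝 (Φ y)) := by
    have := hσ.continuous.tendsto 0
    rwa [hσ0] at this
  have hγt : Tendsto γ (𝓝 0) (𝓝 y) := by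
    have := hγ'.continuousAt.tendsto
    rwa [hγ0] at this
  have hγB : ∀ᶠ t in 𝓝 (0 : ℝ), ∀ i ∈ B, f i (γ t) = f i y := by
    filter_upwards [hσt.eventually hΦΨ] with t ht i hi
    rw [← hval _ ⟨i, hi⟩, ← hval _ ⟨i, hi⟩]
    change inner ℝ _ (Φ (Ψ (σ t))) = _
    rw [ht]
    simp only [σ, inner_add_right, inner_smul_right, hd i (hBS hi), mul_zero, add_zero]
  have hγd : ∀ᶠ t in 𝓝 (0 : ℝ), DifferentiableAt ℝ γ t :=
    (hγC.eventually (by simp)).mono fun t ht => ht.differentiableAt one_ne_zero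
  obtain ⟨ε, hε, hball⟩ := Metric.eventually_nhds_iff_ball.1
    ((hγd.and (hγt.eventually hspan)).and hγB)
  refine ⟨γ, hγ0, hγ', Metric.eventually_nhds_iff_ball.2 ⟨ε, hε, fun t ht i hi => ?_⟩⟩
  have hcomp : ∀ i, ∀ s ∈ Metric.ball (0 : ℝ) ε,
      HasDerivAt (fun s => f i (γ s)) (inner ℝ (gradient (f i) (γ s)) (deriv γ s)) s :=
    fun i s hs => (hder i (γ s)).comp_hasDerivAt s (hball s hs).1.1.hasDerivAt
  have hzero : ∀ s ∈ Metric.ball (0 : ℝ) ε, ∀ i ∈ S,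
      inner ℝ (gradient (f i) (γ s)) (deriv γ s) = 0 := by
    intro s hs i hi
    have hBz : ∀ j ∈ B, inner ℝ (gradient (f j) (γ s)) (deriv γ s) = 0 := fun j hj => by
      refine (hcomp j s hs).unique ((hasDerivAt_const s (f j y)).congr_of_eventuallyEq ?_)
      filter_upwards [Metric.isOpen_ball.mem_nhds hs] with r hr
      exact (hball r hr).2 j hj
    have hmem := (hball s hs).1.2 ⟨i, hi, rfl⟩
    have hle : Submodule.span ℝ ((fun i => gradient (f i) (γ s)) '' B) ≤
        LinearMap.ker (innerₗ H (deriv γ s)) := by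
      refine Submodule.span_le.2 ?_
      rintro _ ⟨j, hj, rfl⟩
      simpa [real_inner_comm] using hBz j hj
    simpa [real_inner_comm] using hle hmem
  have := Metric.isOpen_ball.is_const_of_deriv_eq_zero
    (convex_ball (0 : ℝ) ε).isPreconnected
    (fun s hs => (hcomp i s hs).differentiableAt.differentiableWithinAt)
    (fun s hs => (hcomp i s hs).deriv.trans (hzero s hs i hi)) ht (Metric.mem_ball_self hε)
  simpa only [hγ0] using this

end Arc

/-! ### Linearized constraints and feasible arcs -/

section Constraints

variable {ι H : Type*} [NormedAddCommGroup H] [InnerProductSpace ℝ H] [CompleteSpace H]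

/-- A Hoffman-type estimate: if `v` violates the homogeneous system `⟪a i, d⟫ = 0`, `i ∈ B`,
`⟪a i, d⟫ ≤ 0`, `i ∈ S`, by at most `r`, then some solution lies within `C * r` of `v`. -/
theorem exists_near_polar_cone [DecidableEq ι] (a : ι → H) {B S : Finset ι}
    (hB : LinearIndepOn ℝ a (B : Set ι)) (hBS : B ⊆ S) {C : ℝ} (hC : 0 < C)
    (hbound : ∀ T, B ⊆ T → T ⊆ S → LinearIndepOn ℝ a (T : Set ι) →
      ∀ l : ι → ℝ, ∑ i ∈ T, |l i| ≤ C * ‖∑ i ∈ T, l i • a i‖)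
    {v : H} {r : ℝ} (hr : 0 ≤ r) (hS : ∀ i ∈ S, inner ℝ (a i) v ≤ r)
    (hBr : ∀ i ∈ B, |inner ℝ (a i) v| ≤ r) :
    ∃ d : H, ‖v - d‖ ≤ C * r ∧ (∀ i ∈ B, inner ℝ (a i) d = 0) ∧
      ∀ i ∈ S, inner ℝ (a i) d ≤ 0 := by
  obtain ⟨T, hBT, hTS, hT, l, horth, hl, hd0, hd⟩ := exists_polyhedral_projection a hB hBS v
  set c := ∑ i ∈ T, l i • a i with hc
  refine ⟨v - c, ?_, hd0, hd⟩
  rw [sub_sub_cancel]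
  have h1 : ‖c‖ ^ 2 = ∑ i ∈ T, l i * inner ℝ (a i) v := by
    rw [inner_sub_left, real_inner_self_eq_norm_sq, sub_eq_zero] at horth
    rw [← horth, hc, inner_sum]
    exact Finset.sum_congr rfl fun i _ => by rw [inner_smul_right, real_inner_comm]
  have h2 : ∑ i ∈ T, l i * inner ℝ (a i) v ≤ (∑ i ∈ T, |l i|) * r := by
    rw [Finset.sum_mul]
    refine Finset.sum_le_sum fun i hi => ?_
    by_cases hiB : i ∈ B
    · exact (le_abs_self _).trans (by rw [abs_mul]; gcongr; exact hBr i hiB)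
    · rw [abs_of_nonneg (hl i hi hiB)]
      exact mul_le_mul_of_nonneg_left (hS i (hTS hi)) (hl i hi hiB)
  have h3 := mul_le_mul_of_nonneg_right (hbound T hBT hTS hT l) hr
  rcases (norm_nonneg c).eq_or_lt with h0 | h0
  · rw [← h0]
    positivity
  · refine le_of_mul_le_mul_left ?_ h0
    rw [← hc] at h3
    linarith

/-- Under constant rank near `y`, every direction of the linearized cone is tangent to the feasible
set (the Abadie property). Constraints that are active with `⟪∇ f i y, d⟫ = 0` are kept constant
along the arc, and the remaining inequalities are strict at `y` or to first order. -/
theorem exists_feasible_arc [Finite ι] {f : ι → H → ℝ}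
    (hf : ∀ i, Differentiable ℝ (f i)) (hg : ∀ i, Continuous (gradient (f i))) {I I₀ : Set ι}
    {y : H} (hyI : ∀ i ∈ I, f i y ≤ 0) (hyI₀ : ∀ i ∈ I₀, f i y = 0)
    (hrank : ∀ K ⊆ {i | i ∈ I ∧ f i y = 0}, ∀ᶠ x in 𝓝 y,
      Set.finrank ℝ ((fun i => gradient (f i) x) '' (I₀ ∪ K)) =
        Set.finrank ℝ ((fun i => gradient (f i) y) '' (I₀ ∪ K)))
    {d : H} (hdI₀ : ∀ i ∈ I₀, inner ℝ (gradient (f i) y) d = 0)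
    (hdI : ∀ i ∈ I, f i y = 0 → inner ℝ (gradient (f i) y) d ≤ 0) :
    ∃ γ : ℝ → H, γ 0 = y ∧ HasDerivAt γ d 0 ∧
      ∀ᶠ t in 𝓝[>] (0 : ℝ), (∀ i ∈ I, f i (γ t) ≤ 0) ∧ ∀ i ∈ I₀, f i (γ t) = 0 := by
  set K : Set ι := {i | (i ∈ I ∧ f i y = 0) ∧ inner ℝ (gradient (f i) y) d = 0} with hK
  obtain ⟨B, hBS, hB, -, hev⟩ := exists_eventually_basis
    (a := fun x i => gradient (f i) x) (fun i => (hg i).tendsto y)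
    (hrank K fun i hi => hi.1)
  obtain ⟨γ, hγ0, hγ', hγ⟩ := exists_arc_of_subset_span hf hg hBS hB (hev.mono fun x hx => hx.2)
    (d := d) (by
      rintro i (hi | hi)
      exacts [hdI₀ i hi, hi.2])
  refine ⟨γ, hγ0, hγ', ?_⟩
  have hI : ∀ i, ∀ᶠ t in 𝓝[>] (0 : ℝ), i ∈ I → f i (γ t) ≤ 0 := by
    intro i
    by_cases hi : i ∈ I
    swap
    · exact Eventually.of_forall fun t h => absurd h hi
    rcases (hyI i hi).lt_or_eq with hlt | heq
    · have h1 : Tendsto (fun t => f i (γ t)) (𝓝 0) (𝓝 (f i (γ 0))) :=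
        (((hf i).continuous.continuousAt).comp hγ'.continuousAt).tendsto
      rw [hγ0] at h1
      exact ((h1.eventually_lt_const hlt).filter_mono nhdsWithin_le_nhds).mono fun t ht _ => ht.le
    · rcases (hdI i hi heq).lt_or_eq with hdlt | hdeq
      · have h1 : HasDerivAt (fun t => f i (γ t)) (inner ℝ (gradient (f i) y) d) 0 := by
          have := ((hf i) y).hasGradientAt.hasFDerivAt
          rw [← hγ0] at this
          have := this.comp_hasDerivAt (0 : ℝ) hγ'
          rwa [InnerProductSpace.toDual_apply_apply, hγ0] at this
        have h2 := (hasDerivAt_iff_tendsto_slope.1 h1).eventually_lt_const hdlt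
        have h3 : 𝓝[>] (0 : ℝ) ≤ 𝓝[≠] 0 := nhdsWithin_mono _ fun t ht => ne_of_gt ht
        filter_upwards [h3 h2, self_mem_nhdsWithin] with t ht ht0 _
        rw [slope_def_field, hγ0, heq, sub_zero, sub_zero, div_neg_iff] at ht
        have ht0 : 0 < t := ht0
        rcases ht with ht | ht
        · linarith
        · exact ht.1.le
      · exact (hγ.filter_mono nhdsWithin_le_nhds).mono fun t ht _ =>
          ((ht i (Or.inr ⟨⟨hi, heq⟩, hdeq⟩)).trans heq).le
  filter_upwards [eventually_all.2 hI, nhdsWithin_le_nhds hγ] with t h1 h2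
  exact ⟨h1, fun i hi => (h2 i (Or.inl hi)).trans (hyI₀ i hi)⟩

/-- Moving from `y` along an arc in `F` whose velocity `d` approximates `x - y` up to half of its
norm brings `y` closer to `x` at a rate proportional to the displacement. -/
theorem exists_closer_of_arc {E : Type*} [NormedAddCommGroup E] [NormedSpace ℝ E] {F : Set E}
    {x y d : E} (hxy : x ≠ y) (hd : ‖x - y - d‖ ≤ ‖x - y‖ / 2) {γ : ℝ → E} (hγ0 : γ 0 = y)
    (hγ : HasDerivAt γ d 0) (hF : ∀ᶠ t in 𝓝[>] (0 : ℝ), γ t ∈ F) :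
    ∃ y' ∈ F, y' ≠ y ∧ ‖x - y'‖ + 1 / 8 * ‖y - y'‖ ≤ ‖x - y‖ := by
  have hpos : 0 < ‖x - y‖ := norm_pos_iff.2 (sub_ne_zero.2 hxy)
  have h1 := (hasDerivAt_iff_isLittleO.1 hγ).def (show 0 < ‖x - y‖ / 8 by positivity)
  obtain ⟨t, ⟨htF, ht⟩, ht0, ht1⟩ := ((hF.and (nhdsWithin_le_nhds h1)).and
    (Ioo_mem_nhdsGT one_pos)).exists
  rw [hγ0, sub_zero, Real.norm_of_nonneg ht0.le] at ht
  have h2 : ‖x - γ t‖ ≤ (1 - t) * ‖x - y‖ + t * (‖x - y‖ / 2) + ‖x - y‖ / 8 * t := by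
    have : x - γ t = (1 - t) • (x - y) + t • (x - y - d) - (γ t - y - t • d) := by
      module
    rw [this]
    refine (norm_sub_le _ _).trans (add_le_add ((norm_add_le _ _).trans ?_) ht)
    rw [norm_smul, norm_smul, Real.norm_of_nonneg ht0.le,
      Real.norm_of_nonneg (sub_nonneg.2 ht1.le)]
    gcongr
  have h3 : ‖y - γ t‖ ≤ t * (‖x - y‖ + ‖x - y‖ / 2) + ‖x - y‖ / 8 * t := by
    have : y - γ t = t • ((x - y - d) - (x - y)) - (γ t - y - t • d) := by module
    rw [this]
    refine (norm_sub_le _ _).trans (add_le_add ?_ ht)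
    rw [norm_smul, Real.norm_of_nonneg ht0.le]
    have := norm_sub_le (x - y - d) (x - y)
    gcongr
    linarith
  -- With `N = ‖x - y‖`, the distance drops by at least `3 / 8 * t * N`, while the displacement is
  -- at most `13 / 8 * t * N`; the rate `1 / 8` is below `3 / 13`.
  have h4 := mul_pos ht0 hpos
  refine ⟨γ t, htF, fun h => ?_, by linarith⟩
  rw [h] at h2
  linarith

end Constraints

/-! ### Parametric systems -/

namespace ParamSystem

variable {ι G H : Type*} [NormedAddCommGroup H] [InnerProductSpace ℝ H] [CompleteSpace H]

theorem RCRCQ.eventually [TopologicalSpace G] [Finite ι] {I I₀ : Set ι} {h : ι → G → H → ℝ}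
    {P : Set G} {X : Set H} {p₀ : G} {x₀ : H} (hr : RCRCQ I I₀ h P X p₀ x₀) :
    ∀ᶠ z in 𝓝[P ×ˢ X] (p₀, x₀), ∀ K ⊆ active I h p₀ x₀,
      gradRank h (I₀ ∪ K) z.1 z.2 = gradRank h (I₀ ∪ K) p₀ x₀ := by
  refine eventually_all.2 fun K => ?_
  by_cases hK : K ⊆ active I h p₀ x₀
  · obtain ⟨W, hW, hWr⟩ := hr K hK
    filter_upwards [inter_mem_nhdsWithin _ hW] with z hz _
    exact hWr z ⟨hz.2, hz.1⟩
  · exact Eventually.of_forall fun z h => absurd h hK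

theorem eventually_active_subset {ι G H : Type*} [TopologicalSpace G] [TopologicalSpace H]
    [Finite ι] {I : Set ι} {h : ι → G → H → ℝ}
    (h_cont : ∀ i, Continuous fun z : G × H => h i z.1 z.2) (p₀ : G) (x₀ : H) :
    ∀ᶠ z in 𝓝 (p₀, x₀), active I h z.1 z.2 ⊆ active I h p₀ x₀ := by
  have : ∀ i, ∀ᶠ z in 𝓝 (p₀, x₀), h i p₀ x₀ ≠ 0 → h i z.1 z.2 ≠ 0 := fun i => by
    by_cases hi : h i p₀ x₀ = 0
    · exact Eventually.of_forall fun z h => absurd hi h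
    · exact (((h_cont i).tendsto (p₀, x₀)).eventually_ne hi).mono fun z hz _ => hz
  filter_upwards [eventually_all.2 this] with z hz i hi
  exact ⟨hi.1, not_not.1 fun h0 => hz i h0 hi.2⟩

/-- Uniformly near the reference point, a vector `v` that nearly satisfies the linearized
constraints has an exact solution of them within `‖v‖ / 2`. The constant is uniform because, by
constant rank, sets of gradients that are linearly independent nearby already are so at the
reference point. -/
theorem RCRCQ.eventually_exists_linearized_near [TopologicalSpace G] [Finite ι] {I I₀ : Set ι}
    {h : ι → G → H → ℝ} {P : Set G} {X : Set H} {p₀ : G} {x₀ : H}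
    (h_cont : ∀ i, Continuous fun z : G × H => h i z.1 z.2)
    (h_grad : ∀ i, Continuous fun z : G × H => gradient (h i z.1) z.2)
    (hr : RCRCQ I I₀ h P X p₀ x₀) :
    ∃ η : ℝ, 0 < η ∧ ∀ᶠ z in 𝓝[P ×ˢ X] (p₀, x₀), ∀ v : H,
      (∀ i ∈ I₀, |inner ℝ (gradient (h i z.1) z.2) v| ≤ η * ‖v‖) →
      (∀ i ∈ active I h z.1 z.2, inner ℝ (gradient (h i z.1) z.2) v ≤ η * ‖v‖) →
      ∃ d : H, ‖v - d‖ ≤ ‖v‖ / 2 ∧ (∀ i ∈ I₀, inner ℝ (gradient (h i z.1) z.2) d = 0) ∧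
        ∀ i ∈ active I h z.1 z.2, inner ℝ (gradient (h i z.1) z.2) d ≤ 0 := by
  classical
  cases nonempty_fintype ι
  set a : G × H → ι → H := fun z i => gradient (h i z.1) z.2 with ha_def
  have ha : ∀ i, Tendsto (fun z => a z i) (𝓝[P ×ˢ X] (p₀, x₀)) (𝓝 (a (p₀, x₀) i)) := fun i =>
    ((h_grad i).tendsto (p₀, x₀)).mono_left nhdsWithin_le_nhds
  -- `B` indexes a basis of the equality gradients. It is contained in all sets `T` of
  -- Carathéodory's theorem because constant rank is available only for sets that contain all of
  -- `I₀`.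
  obtain ⟨B, hBI₀, -, hspan₀, hBev⟩ := exists_eventually_basis ha (S := I₀) (by
    filter_upwards [hr.eventually] with z hz
    have := hz ∅ (empty_subset _)
    rwa [union_empty] at this)
  obtain ⟨C, hC, hCev⟩ := eventually_bound_coeff ha
  refine ⟨1 / (2 * C), by positivity, ?_⟩
  filter_upwards [hr.eventually, hBev, hCev,
    nhdsWithin_le_nhds (eventually_active_subset (I := I) h_cont p₀ x₀)]
    with z hrz hBz hCz hact v hv₀ hv
  obtain ⟨hBz, hspan⟩ := hBz
  obtain ⟨d, hd, hdB, hdS⟩ := exists_near_polar_cone (a z) (B := B.toFinset)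
    (S := (B ∪ active I h z.1 z.2).toFinset) (by simpa using hBz)
    (toFinset_subset_toFinset.2 subset_union_left) hC (fun T hBT hTS hT l => by
      refine hCz T ?_ l
      have hT' : (T : Set ι) = B ∪ (T \ B) := (union_sdiff_cancel (by simpa using hBT)).symm
      rw [hT'] at hT ⊢
      refine linearIndepOn_of_finrank_eq hBI₀ hspan₀ hT (hrz _ fun i hi => hact ?_)
      have : i ∈ (B ∪ active I h z.1 z.2).toFinset := hTS hi.1
      exact (mem_toFinset.1 this).resolve_left hi.2)
    (v := v) (r := 1 / (2 * C) * ‖v‖) (by positivity) (fun i hi => by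
      rcases mem_toFinset.1 hi with hi | hi
      · exact (le_abs_self _).trans (hv₀ i (hBI₀ hi))
      · exact hv i hi) (fun i hi => hv₀ i (hBI₀ (mem_toFinset.1 hi)))
  refine ⟨d, hd.trans (le_of_eq (by field_simp)), fun i hi => ?_,
    fun i hi => hdS i (mem_toFinset.2 (Or.inr hi))⟩
  have hle : Submodule.span ℝ (a z '' B) ≤ LinearMap.ker (innerₗ H d) := by
    refine Submodule.span_le.2 ?_
    rintro _ ⟨j, hj, rfl⟩
    simpa [real_inner_comm] using hdB j (mem_toFinset.2 hj)
  have := hle (hspan ⟨i, hi, rfl⟩)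
  simpa [real_inner_comm, a] using this


variable {ι G H : Type*} [NormedAddCommGroup G] [NormedAddCommGroup H] [InnerProductSpace ℝ H]
  [CompleteSpace H]

/-- The constraint functions are Lipschitz continuous in the parameter, with a common constant and
neighbourhood. -/
theorem exists_lipschitz_in_parameter {ι G H : Type*} [NormedAddCommGroup G]
    [NormedAddCommGroup H] [Finite ι] {h : ι → G → H → ℝ} {p₀ : G} {x₀ : H}
    (h_lip : ∀ i, ∃ L : ℝ≥0, ∃ W ∈ 𝓝 (p₀, x₀),
      LipschitzOnWith L (fun z : G × H => h i z.1 z.2) W) :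
    ∃ M : ℝ, 0 < M ∧ ∃ W ∈ 𝓝 (p₀, x₀), ∀ i p₁ p₂ x, (p₁, x) ∈ W → (p₂, x) ∈ W →
      |h i p₂ x - h i p₁ x| ≤ M * ‖p₂ - p₁‖ := by
  cases nonempty_fintype ι
  choose L W hW hL using h_lip
  refine ⟨∑ i, (L i : ℝ) + 1, by positivity, ⋂ i, W i, iInter_mem.2 hW,
    fun i p₁ p₂ x h₁ h₂ => ?_⟩
  have h3 := (hL i).dist_le_mul (p₂, x) (mem_iInter.1 h₂ i) (p₁, x) (mem_iInter.1 h₁ i)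
  rw [Real.dist_eq, dist_prod_same_right, dist_eq_norm] at h3
  refine h3.trans ?_
  gcongr
  have := Finset.single_le_sum (f := fun i => (L i : ℝ)) (fun i _ => (L i).2) (Finset.mem_univ i)
  linarith

theorem abs_sub_sub_inner_le {f : H → ℝ} (hf : Differentiable ℝ f) {s : Set H} (hs : Convex ℝ s)
    {g : H} {ε : ℝ} (hg : ∀ x ∈ s, ‖gradient f x - g‖ ≤ ε) {x y : H} (hx : x ∈ s) (hy : y ∈ s) :
    |f x - f y - inner ℝ (gradient f y) (x - y)| ≤ 2 * ε * ‖x - y‖ := by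
  have h1 := hs.norm_image_sub_le_of_norm_hasFDerivWithin_le' (C := 2 * ε)
    (φ := InnerProductSpace.toDual ℝ H (gradient f y))
    (fun z _ => (hf z).hasGradientAt.hasFDerivAt.hasFDerivWithinAt) (fun z hz => by
      rw [← map_sub, LinearIsometryEquiv.norm_map, ← sub_sub_sub_cancel_right _ _ g]
      refine (norm_sub_le _ _).trans ?_
      have := hg z hz
      have := hg y hy
      linarith) hy hx
  simpa only [Real.norm_eq_abs, InnerProductSpace.toDual_apply_apply] using h1

theorem isClosed_feasible {ι G X : Type*} [TopologicalSpace X] {I I₀ : Set ι}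
    {h : ι → G → X → ℝ} {p : G} (hc : ∀ i, Continuous (h i p)) :
    IsClosed (feasible I I₀ h p) := by
  have : feasible I I₀ h p = (⋂ i ∈ I, {x | h i p x ≤ 0}) ∩ ⋂ i ∈ I₀, {x | h i p x = 0} := by
    ext x
    simp [feasible]
  rw [this]
  exact (isClosed_biInter fun i _ => isClosed_le (hc i) continuous_const).inter
    (isClosed_biInter fun i _ => isClosed_eq (hc i) continuous_const)

/-- If the residual of `x` is small compared with `‖x - y‖`, the feasible point `y` is not a best
approximation of `x`: another feasible point is closer, at rate `1 / 8`. -/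
theorem RCRCQ.exists_closer_feasible [Finite ι] {I I₀ : Set ι} {h : ι → G → H → ℝ} {P : Set G}
    {p₀ : G} {x₀ : H} (h_cont : ∀ i, Continuous fun z : G × H => h i z.1 z.2)
    (h_diff : ∀ i p, Differentiable ℝ (h i p))
    (h_grad : ∀ i, Continuous fun z : G × H => gradient (h i z.1) z.2)
    (hr : RCRCQ I I₀ h P univ p₀ x₀) :
    ∃ η : ℝ, 0 < η ∧ ∃ r : ℝ, 0 < r ∧ ∀ p ∈ Metric.ball p₀ r ∩ P, ∀ x ∈ Metric.ball x₀ r,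
      ∀ y ∈ Metric.ball x₀ r ∩ feasible I I₀ h p, x ≠ y →
      (∀ i ∈ I, h i p x ≤ η * ‖x - y‖) → (∀ i ∈ I₀, |h i p x| ≤ η * ‖x - y‖) →
      ∃ y' ∈ feasible I I₀ h p, y' ≠ y ∧ ‖x - y'‖ + 1 / 8 * ‖y - y'‖ ≤ ‖x - y‖ := by
  obtain ⟨η, hη, hlin⟩ := hr.eventually_exists_linearized_near h_cont h_grad
  have hgrad : ∀ᶠ z in 𝓝 (p₀, x₀), ∀ i,
      ‖gradient (h i z.1) z.2 - gradient (h i p₀) x₀‖ < η / 4 := eventually_all.2 fun i => by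
    have h1 := (((h_grad i).tendsto (p₀, x₀)).sub_const (gradient (h i p₀) x₀)).norm
    rw [sub_self, norm_zero] at h1
    exact h1.eventually_lt_const (by positivity)
  have hact := eventually_active_subset (I := I) h_cont p₀ x₀
  obtain ⟨r, hr0, hball⟩ := Metric.eventually_nhds_iff_ball.1
    (((eventually_nhdsWithin_iff.1 (hlin.and hr.eventually)).and hgrad).and hact)
  refine ⟨η / 2, by positivity, r, hr0, fun p hp x hx y hy hxy hI hI₀ => ?_⟩
  have hz : ∀ w ∈ Metric.ball x₀ r, (p, w) ∈ Metric.ball (p₀, x₀) r := fun w hw => by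
    rw [← ball_prod_same]
    exact ⟨hp.1, hw⟩
  have happrox : ∀ i, |h i p x - h i p y - inner ℝ (gradient (h i p) y) (x - y)| ≤
      η / 2 * ‖x - y‖ := fun i => by
    have := abs_sub_sub_inner_le (h_diff i p) (convex_ball x₀ r)
      (fun w hw => ((hball _ (hz w hw)).1.2 i).le) hx hy.1
    linarith
  have hyP : (p, y) ∈ P ×ˢ (univ : Set H) := ⟨hp.2, trivial⟩
  obtain ⟨d, hd, hdI₀, hdI⟩ := ((hball _ (hz y hy.1)).1.1 hyP).1 (x - y) (fun i hi => by
    have h1 := happrox i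
    have h2 := hI₀ i hi
    rw [hy.2.2 i hi, sub_zero] at h1
    rw [abs_le] at h1 h2 ⊢
    constructor <;> linarith) (fun i hi => by
    have h1 := (abs_le.1 (happrox i)).1
    have h2 := hI i hi.1
    have h3 : h i p y = 0 := hi.2
    rw [h3, sub_zero] at h1
    dsimp only
    linarith)
  have hcont : ∀ i, Continuous (gradient (h i p)) := fun i =>
    (h_grad i).comp (Continuous.prodMk_right p)
  obtain ⟨γ, hγ0, hγ', hγ⟩ := exists_feasible_arc (fun i => h_diff i p) hcont hy.2.1 hy.2.2
    (fun K hK => by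
      have hK' := hK.trans (hball _ (hz y hy.1)).2
      filter_upwards [Metric.isOpen_ball.mem_nhds hy.1] with w hw
      exact (((hball _ (hz w hw)).1.1 ⟨hp.2, trivial⟩).2 K hK').trans
        (((hball _ (hz y hy.1)).1.1 hyP).2 K hK').symm)
    hdI₀ (fun i hi hi0 => hdI i ⟨hi, hi0⟩)
  exact exists_closer_of_arc hxy hd hγ0 hγ' hγ

/-- The Lipschitz-like property, for any finite family of constraints and any parameter set `P`. -/
theorem lipschitzLikeAt_feasible [Finite ι] {I I₀ : Set ι} {h : ι → G → H → ℝ} {P : Set G}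
    {p₀ : G} {x₀ : H} (h_cont : ∀ i, Continuous fun z : G × H => h i z.1 z.2)
    (h_diff : ∀ i p, Differentiable ℝ (h i p))
    (h_grad : ∀ i, Continuous fun z : G × H => gradient (h i z.1) z.2)
    (h_lip : ∀ i, ∃ L : ℝ≥0, ∃ W ∈ 𝓝 (p₀, x₀),
      LipschitzOnWith L (fun z : G × H => h i z.1 z.2) W)
    (h_lsc : LowerSemicontAt (feasible I I₀ h) P p₀ x₀)
    (h_rcrcq : RCRCQ I I₀ h P univ p₀ x₀) :
    LipschitzLikeAt (feasible I I₀ h) P p₀ x₀ := by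
  obtain ⟨M, hM, W, hW, hMW⟩ := exists_lipschitz_in_parameter h_lip
  obtain ⟨η, hη, r₁, hr₁, hdesc⟩ := h_rcrcq.exists_closer_feasible h_cont h_diff h_grad
  obtain ⟨r₂, hr₂, hWr⟩ := Metric.mem_nhds_iff.1 hW
  set r := min r₁ r₂
  have hr : 0 < r := lt_min hr₁ hr₂
  obtain ⟨U, hU, hUF⟩ := h_lsc (Metric.ball x₀ (r / 4)) (Metric.ball_mem_nhds _ (by positivity))
  refine ⟨M / η, by positivity, U ∩ Metric.ball p₀ r,
    inter_mem hU (Metric.ball_mem_nhds _ hr), Metric.ball x₀ (r / 4),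
    Metric.ball_mem_nhds _ (by positivity), ?_⟩
  rintro p₁ ⟨⟨-, hp₁⟩, -⟩ p₂ ⟨⟨hp₂U, hp₂⟩, hp₂P⟩ x ⟨hxF, hx⟩
  rcases eq_or_ne p₁ p₂ with rfl | hne
  -- The scaled ball is `0 • ball 0 1 = {0}` when the parameters coincide.
  · refine ⟨x, hxF, 0, ⟨0, Metric.mem_ball_self one_pos, by simp⟩, add_zero x⟩
  have hlpos : 0 < M / η * ‖p₂ - p₁‖ :=
    mul_pos (by positivity) (norm_pos_iff.2 (sub_ne_zero.2 hne.symm))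
  suffices hy : ∃ y ∈ feasible I I₀ h p₂, ‖x - y‖ < M / η * ‖p₂ - p₁‖ by
    obtain ⟨y, hyF, hy⟩ := hy
    refine ⟨y, hyF, x - y, ?_, add_sub_cancel y x⟩
    rwa [smul_unitBall_of_pos hlpos, mem_ball_zero_iff]
  by_contra! hcon
  have hxW : ∀ p ∈ Metric.ball p₀ r, (p, x) ∈ W := fun p hp => hWr (by
    rw [← ball_prod_same]
    exact ⟨Metric.ball_subset_ball (min_le_right _ _) hp, Metric.ball_subset_ball
      (by have := min_le_right r₁ r₂; linarith) hx⟩)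
  have hclose : ∀ i, ∀ y ∈ feasible I I₀ h p₂, |h i p₂ x - h i p₁ x| ≤ η * ‖x - y‖ :=
    fun i y hy => by
      refine (hMW i p₁ p₂ x (hxW p₁ hp₁) (hxW p₂ hp₂)).trans ?_
      have := mul_le_mul_of_nonneg_left (hcon y hy) hη.le
      rwa [← mul_assoc, mul_div_cancel₀ _ hη.ne'] at this
  -- If no feasible point is close, the residual of `x` at `p₂` is at most `η * ‖x - y‖` for every
  -- feasible `y`, so descent is possible everywhere in `S`, against Ekeland's principle. The radii
  -- keep `S` inside the ball where `hdesc` applies.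
  let S : Set H := feasible I I₀ h p₂ ∩ Metric.closedBall x (r / 2)
  have hSc : IsClosed S := (isClosed_feasible fun i =>
    (h_diff i p₂).continuous).inter Metric.isClosed_closedBall
  have : CompleteSpace S := hSc.completeSpace_coe
  obtain ⟨y₀, hy₀F, hy₀⟩ := hUF p₂ ⟨hp₂U, hp₂P⟩
  have : Nonempty S := ⟨y₀, hy₀F, by
    have h1 := dist_triangle_right y₀ x x₀
    rw [Metric.mem_ball] at hx hy₀
    rw [Metric.mem_closedBall]
    linarith⟩
  obtain ⟨⟨y, hyF, hyr⟩, hy⟩ := exists_no_descent (X := S) (f := fun y => ‖x - y‖)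
    (by fun_prop) (fun _ => norm_nonneg _) (c := 1 / 8) (by norm_num)
  have hyball : y ∈ Metric.ball x₀ r₁ := by
    have h1 := dist_triangle y x x₀
    have h2 := min_le_left r₁ r₂
    rw [Metric.mem_ball] at hx ⊢
    rw [Metric.mem_closedBall] at hyr
    linarith
  obtain ⟨y', hy'F, hne', hy'⟩ := hdesc p₂
    ⟨Metric.ball_subset_ball (min_le_left _ _) hp₂, hp₂P⟩ x
    (Metric.ball_subset_ball (by have := min_le_left r₁ r₂; linarith) hx) y ⟨hyball, hyF⟩
    (fun h => by
      have := hcon y hyF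
      rw [h, sub_self, norm_zero] at this
      linarith)
    (fun i hi => by
      have h1 := (abs_le.1 (hclose i y hyF)).2
      have h2 := hxF.1 i hi
      linarith)
    (fun i hi => by simpa [hxF.2 i hi] using hclose i y hyF)
  have hy'S : y' ∈ S := by
    refine ⟨hy'F, ?_⟩
    rw [Metric.mem_closedBall, dist_comm, dist_eq_norm] at hyr ⊢
    have := norm_nonneg (y - y')
    linarith
  rw [← dist_eq_norm y y'] at hy'
  exact hne' (congrArg Subtype.val (hy ⟨y', hy'S⟩ hy'))

end ParamSystem

end

theorem mainTheorem1
    {G : Type*} [NormedAddCommGroup G] [NormedSpace ℝ G]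
    {H : Type*} [NormedAddCommGroup H] [InnerProductSpace ℝ H] [CompleteSpace H]
    (m n : ℕ) (hmn : m ≤ n) (h : Fin n → G → H → ℝ)
    (I I₀ : Set (Fin n)) (hI : I = {i : Fin n | (i : ℕ) < m}) (hI₀ : I₀ = {i : Fin n | m ≤ (i : ℕ)})
    (h_cont : ∀ i, Continuous fun z : G × H => h i z.1 z.2)
    (h_diff : ∀ i p, Differentiable ℝ (h i p))
    (h_grad : ∀ i, Continuous fun z : G × H => gradient (h i z.1) z.2)
    (F : G → Set H) (hF : F = ParamSystem.feasible I I₀ h)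
    (p₀ : G) (x₀ : H) (hx₀ : x₀ ∈ F p₀)
    (h_lip : ∀ i, ∃ L : ℝ≥0, ∃ W ∈ 𝓝 (p₀, x₀),
      LipschitzOnWith L (fun z : G × H => h i z.1 z.2) W)
    (h_lsc : ParamSystem.LowerSemicontAt F (ParamSystem.dom F) p₀ x₀)
    (h_rcrcq : ParamSystem.RCRCQ I I₀ h (ParamSystem.dom F) Set.univ p₀ x₀) :
    ParamSystem.LipschitzLikeAt F (ParamSystem.dom F) p₀ x₀ := by
  subst hF
  exact ParamSystem.lipschitzLikeAt_feasible h_cont h_diff h_grad h_lip h_lsc h_rcrcq
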